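/- Let $H$ and $P$ be natural numbers with $H\neq P$. On a probability space, let $\mathbf z=(z_1,\dots,z_H)$ be a vector of $H$ independent standard Gaussian random variables and let $\mathbf y=(y_1,\dots,y_P)$ be a vector of $P$ independent standard Gaussian random variables (no assumption is made on the joint distribution of $\mathbf z$ and $\mathbf y$). Then $\mathbf z$ and $\mathbf y$ cannot be generating factors of each other: there are no continuous functions $f:\mathbb R^H\to\mathbb R^P$ and $g:\mathbb R^P\to\mathbb R^H$ such that $$\mathbf z=g(\mathbf y)\quad\text{and}\quad \mathbf y=f(\mathbf z)\qquad\text{almost surely.}$$ -/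

import Mathlib

open MeasureTheory ProbabilityTheory

/-!
If `z = g(y)` and `y = f(z)` almost surely, then `g ∘ f` is almost surely the identity under the law
of `z`. This law charges every nonempty open set, so by continuity `g ∘ f = id` everywhere, and
likewise `f ∘ g = id`. It remains to see that `g ∘ f = id` is impossible when `f : E → F` and
`g : F → E` are continuous and `dim F < dim E`. A `C¹` approximation `G` of `g` has a range of
measure zero, whereas `G ∘ f` stays at bounded distance from the identity, and such continuous maps
are surjective.

Surjectivity reduces to the no-retraction theorem for the ball, which is proved by Milnor's volume
argument: if `w` is Lipschitz and vanishes off `s`, then `∫ₛ det (1 + t w')` is a polynomial in `t`.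
For small `t` the map `x ↦ x + t w x` is a bijection preserving `s`, so the polynomial is
constantly the volume of `s`, also at `t = 1`. For a retraction `r` of the ball `s` onto its sphere
and `w = r - id`, the value at `t = 1` is the integral of `det r'`, which vanishes since `‖r‖` is
constant.
-/

open Metric Set Module
open scoped NNReal Polynomial Topology

section Extension

theorem inter_frontier_nonempty_of_isPreconnected {X : Type*} [TopologicalSpace X] {s t : Set X}
    (ht : IsPreconnected t) (hs : (t ∩ s).Nonempty) (hsc : (t ∩ sᶜ).Nonempty) :
    (t ∩ frontier s).Nonempty := by
  by_contra! hempty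
  have hmem : ∀ x ∈ t, x ∉ frontier s := fun x hx hxf => notMem_empty x (hempty ▸ ⟨hx, hxf⟩)
  obtain ⟨x, hxt, hxs⟩ := hs
  obtain ⟨y, hyt, hys⟩ := hsc
  have hcover : t ⊆ interior s ∪ (closure s)ᶜ := fun a ha =>
    or_iff_not_imp_left.2 fun hint hcl => hmem a ha ⟨hcl, hint⟩
  obtain ⟨a, -, hai, hac⟩ := ht _ _ isOpen_interior isClosed_closure.isOpen_compl hcover
    ⟨x, hxt, (hcover hxt).resolve_right fun h => h (subset_closure hxs)⟩
    ⟨y, hyt, (hcover hyt).resolve_left fun h => hys (interior_subset h)⟩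
  exact hac (subset_closure (interior_subset hai))

theorem lipschitzWith_indicator_of_eq_zero_on_frontier {E F : Type*} [NormedAddCommGroup E]
    [NormedSpace ℝ E] [NormedAddCommGroup F] {K : ℝ≥0} {u : E → F} {s : Set E} (hs : IsClosed s)
    (hu : LipschitzOnWith K u s) (h0 : ∀ x ∈ frontier s, u x = 0) :
    LipschitzWith K (s.indicator u) := by
  have hcross : ∀ x ∈ s, ∀ y ∉ s, dist (u x) 0 ≤ K * dist x y := by
    intro x hx y hy
    obtain ⟨b, hb, hbs⟩ := inter_frontier_nonempty_of_isPreconnected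
      (convex_segment x y).isPreconnected ⟨x, left_mem_segment ℝ x y, hx⟩
      ⟨y, right_mem_segment ℝ x y, hy⟩
    calc dist (u x) 0 = dist (u x) (u b) := by rw [h0 b hbs]
      _ ≤ K * dist x b := hu.dist_le_mul x hx b (hs.frontier_subset hbs)
      _ ≤ K * dist x y := by
        gcongr
        linarith [dist_add_dist_of_mem_segment hb, dist_nonneg (x := b) (y := y)]
  refine LipschitzWith.of_dist_le_mul fun x y => ?_
  by_cases hx : x ∈ s <;> by_cases hy : y ∈ s
  · simpa only [indicator_of_mem hx, indicator_of_mem hy] using hu.dist_le_mul x hx y hy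
  · simpa only [indicator_of_mem hx, indicator_of_notMem hy] using hcross x hx y hy
  · simpa only [indicator_of_notMem hx, indicator_of_mem hy, dist_comm] using hcross y hy x hx
  · simp only [indicator_of_notMem hx, indicator_of_notMem hy, dist_self]
    positivity

end Extension

section Polynomial

theorem exists_polynomial_eval_eq_det_one_add_smul {R M : Type*} [CommRing R] [Nontrivial R]
    [AddCommGroup M] [Module R M] [Module.Finite R M] [Module.Free R M] (A : M →ₗ[R] M) :
    ∃ p : R[X], p.natDegree ≤ finrank R M ∧ ∀ t : R, p.eval t = LinearMap.det (1 + t • A) := by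
  let b := finBasis R M
  let N := LinearMap.toMatrix b b A
  refine ⟨((Polynomial.X : R[X]) • N.map Polynomial.C + (1 : Matrix _ _ R).map Polynomial.C).det,
    by simpa only [Fintype.card_fin] using Polynomial.natDegree_det_X_add_C_le N 1, fun t => ?_⟩
  rw [← LinearMap.det_toMatrix b, ← Polynomial.coe_evalRingHom, RingHom.map_det]
  congr 1
  ext i j
  rw [map_add (LinearMap.toMatrix b b), map_smul, LinearMap.toMatrix_one]
  by_cases hij : i = j
  · simp [N, hij, add_comm, mul_comm t]
  · simp [N, hij, mul_comm t]

theorem exists_polynomial_eval_eq_integral {X : Type*} [MeasurableSpace X] {μ : Measure X} {n : ℕ}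
    {p : X → ℝ[X]} (hdeg : ∀ x, (p x).natDegree ≤ n)
    (hint : ∀ t : ℝ, Integrable (fun x => (p x).eval t) μ) :
    ∃ q : ℝ[X], ∀ t : ℝ, q.eval t = ∫ x, (p x).eval t ∂μ := by
  let s := Finset.range (n + 1)
  let v : ℕ → ℝ := Nat.cast
  have hinterp : ∀ x, p x = Lagrange.interpolate s v fun i => (p x).eval (v i) := fun x =>
    Lagrange.eq_interpolate Nat.cast_injective.injOn <| by
      rw [Finset.card_range]
      exact (Polynomial.degree_le_of_natDegree_le (hdeg x)).trans_lt
        (WithBot.coe_lt_coe.2 n.lt_succ_self)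
  have heval : ∀ (c : ℕ → ℝ) (t : ℝ), (Lagrange.interpolate s v c).eval t =
      ∑ i ∈ s, c i * (Lagrange.basis s v i).eval t := fun c t => by
    simp only [Lagrange.interpolate_apply, Polynomial.eval_finsetSum, Polynomial.eval_mul,
      Polynomial.eval_C]
  refine ⟨Lagrange.interpolate s v fun i => ∫ x, (p x).eval (v i) ∂μ, fun t => ?_⟩
  calc _ = ∑ i ∈ s, ∫ x, (p x).eval (v i) * (Lagrange.basis s v i).eval t ∂μ := by
        simp only [heval, integral_mul_const]
    _ = ∫ x, ∑ i ∈ s, (p x).eval (v i) * (Lagrange.basis s v i).eval t ∂μ :=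
        (integral_finsetSum _ fun i _ => (hint (v i)).mul_const _).symm
    _ = ∫ x, (p x).eval t ∂μ := integral_congr_ae <| .of_forall fun x => by
        simp only [← heval, ← hinterp]

end Polynomial

section Jacobian

theorem bijective_add_of_lipschitzWith_lt_one {E : Type*} [NormedAddCommGroup E] [CompleteSpace E]
    {K : ℝ≥0} {w : E → E} (hw : LipschitzWith K w) (hK : K < 1) :
    Function.Bijective fun x => x + w x := by
  refine Function.bijective_iff_existsUnique _ |>.2 fun y => ?_
  have hcontr : ContractingWith K fun x => y - w x :=
    ⟨hK, by simpa only [zero_add] using (LipschitzWith.const y).sub hw⟩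
  refine ⟨hcontr.fixedPoint, ?_, fun x hx => hcontr.fixedPoint_unique ?_⟩
  · exact eq_sub_iff_add_eq.1 hcontr.fixedPoint_isFixedPt.symm
  · exact (eq_sub_of_add_eq hx).symm

theorem image_eq_self_of_bijective_of_eq_off {X : Type*} {φ : X → X} {s : Set X}
    (hφ : Function.Bijective φ) (hoff : ∀ x ∉ s, φ x = x) : φ '' s = s := by
  have hcompl : φ '' sᶜ = sᶜ := (image_congr hoff).trans (image_id' _)
  rwa [image_compl_eq hφ, compl_inj_iff] at hcompl

variable {E : Type*} [NormedAddCommGroup E] [NormedSpace ℝ E] [FiniteDimensional ℝ E]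

theorem continuousLinearMap_isUnit_iff_det_ne_zero (A : E →L[ℝ] E) : IsUnit A ↔ A.det ≠ 0 := by
  rw [ContinuousLinearMap.isUnit_iff_bijective, ← isUnit_iff_ne_zero, ContinuousLinearMap.det,
    ← LinearMap.isUnit_iff_isUnit_det, Module.End.isUnit_iff]
  rfl

theorem det_one_add_pos_of_norm_lt_one {A : E →L[ℝ] E} (hA : ‖A‖ < 1) : 0 < (1 + A).det := by
  have := FiniteDimensional.complete ℝ E
  have hne : ∀ t ∈ Icc (0 : ℝ) 1, (1 + t • A).det ≠ 0 := fun t ht => by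
    rw [← continuousLinearMap_isUnit_iff_det_ne_zero, ← sub_neg_eq_add]
    refine isUnit_one_sub_of_norm_lt_one ?_
    rw [norm_neg, norm_smul, Real.norm_of_nonneg ht.1]
    exact (mul_le_of_le_one_left (norm_nonneg A) ht.2).trans_lt hA
  have hcont : Continuous fun t : ℝ => (1 + t • A).det :=
    ContinuousLinearMap.continuous_det.comp (by fun_prop)
  by_contra! hneg
  obtain ⟨t, ht, ht0⟩ := intermediate_value_Icc' zero_le_one hcont.continuousOn
    (show (0 : ℝ) ∈ Icc _ _ by simpa [ContinuousLinearMap.det] using hneg)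
  exact hne t ht ht0

variable [MeasurableSpace E] [BorelSpace E] {K : ℝ≥0} {w : E → E} {s : Set E}

theorem setIntegral_det_one_add_fderiv_of_lt_one (μ : Measure E) [μ.IsAddHaarMeasure]
    (hs : MeasurableSet s) (hw : LipschitzWith K w) (hK : K < 1)
    (hd : ∀ x ∈ s, DifferentiableAt ℝ w x) (h0 : ∀ x ∉ s, w x = 0) :
    ∫ x in s, (1 + fderiv ℝ w x).det ∂μ = μ.real s := by
  have := FiniteDimensional.complete ℝ E
  have hbij := bijective_add_of_lipschitzWith_lt_one hw hK
  have hderiv : ∀ x ∈ s, HasFDerivWithinAt (fun x => x + w x) (1 + fderiv ℝ w x) s x :=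
    fun x hx => ((hasFDerivAt_id x).add (hd x hx).hasFDerivAt).hasFDerivWithinAt
  have hpos : ∀ x, 0 < (1 + fderiv ℝ w x).det := fun x =>
    det_one_add_pos_of_norm_lt_one <| (norm_fderiv_le_of_lipschitz ℝ hw).trans_lt hK
  calc ∫ x in s, (1 + fderiv ℝ w x).det ∂μ
      = ∫ x in s, |(1 + fderiv ℝ w x).det| • (1 : ℝ) ∂μ := by
        simp only [abs_of_pos (hpos _), smul_eq_mul, mul_one]
    _ = ∫ _ in (fun x => x + w x) '' s, (1 : ℝ) ∂μ :=
        (integral_image_eq_integral_abs_det_fderiv_smul μ hs hderiv hbij.1.injOn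
          fun _ => (1 : ℝ)).symm
    _ = μ.real s := by
        rw [image_eq_self_of_bijective_of_eq_off hbij fun x hx => by rw [h0 x hx, add_zero],
          setIntegral_const, smul_eq_mul, mul_one]

theorem integrable_det_one_add_smul_fderiv (μ : Measure E) [IsFiniteMeasure μ]
    (hw : LipschitzWith K w) (t : ℝ) : Integrable (fun x => (1 + t • fderiv ℝ w x).det) μ := by
  have := FiniteDimensional.complete ℝ E
  have hcont : Continuous fun A : E →L[ℝ] E => (1 + t • A).det :=
    ContinuousLinearMap.continuous_det.comp (by fun_prop)
  have := FiniteDimensional.proper ℝ (E →L[ℝ] E)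
  obtain ⟨C, hC⟩ := (isCompact_closedBall (0 : E →L[ℝ] E) K).exists_bound_of_continuousOn
    hcont.continuousOn
  exact Integrable.of_bound (hcont.measurable.comp (measurable_fderiv ℝ w)).aestronglyMeasurable C
    (.of_forall fun x => hC _ <| by simpa using norm_fderiv_le_of_lipschitz ℝ hw)

theorem setIntegral_det_one_add_fderiv (μ : Measure E) [μ.IsAddHaarMeasure]
    (hs : MeasurableSet s) (hμs : μ s ≠ ⊤) (hw : LipschitzWith K w)
    (hd : ∀ x ∈ s, DifferentiableAt ℝ w x) (h0 : ∀ x ∉ s, w x = 0) :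
    ∫ x in s, (1 + fderiv ℝ w x).det ∂μ = μ.real s := by
  have : Fact (μ s < ⊤) := ⟨hμs.lt_top⟩
  choose p hdeg hp using fun x =>
    exists_polynomial_eval_eq_det_one_add_smul (fderiv ℝ w x : E →ₗ[ℝ] E)
  obtain ⟨q, hq⟩ := exists_polynomial_eval_eq_integral (μ := μ.restrict s) hdeg fun t => by
    simpa only [hp] using! integrable_det_one_add_smul_fderiv (μ.restrict s) hw t
  have hsmall : ∀ t ∈ Icc (0 : ℝ) (1 / (K + 1)), q.eval t = μ.real s := by
    intro t ⟨ht0, htK⟩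
    have hlt : ‖t‖₊ * K < 1 := by
      rw [← NNReal.coe_lt_coe, NNReal.coe_mul, coe_nnnorm, Real.norm_of_nonneg ht0]
      calc t * K ≤ 1 / (K + 1) * K := by gcongr
        _ < 1 := by
          rw [one_div_mul_eq_div, div_lt_one (by positivity)]
          exact lt_add_one _
    rw [hq, ← setIntegral_det_one_add_fderiv_of_lt_one μ hs ((lipschitzWith_smul t).comp hw) hlt
      (fun x hx => (hd x hx).const_smul t) fun x hx => by simp [h0 x hx]]
    refine setIntegral_congr_fun hs fun x hx => ?_
    have hsmul : fderiv ℝ ((t • ·) ∘ w) x = t • fderiv ℝ w x := fderiv_fun_const_smul (hd x hx) t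
    rw [hp, hsmul]
    rfl
  have hconst : q = Polynomial.C (μ.real s) := Polynomial.eq_of_infinite_eval_eq _ _ <|
    (Icc_infinite (show (0 : ℝ) < 1 / (K + 1) by positivity)).mono fun t ht => by
      simpa using hsmall t ht
  have hone := hq 1
  simp only [hp, one_smul, hconst, Polynomial.eval_C] at hone
  exact hone.symm

end Jacobian

section Retraction

variable {E : Type*} [NormedAddCommGroup E] [InnerProductSpace ℝ E] [FiniteDimensional ℝ E]

theorem det_fderiv_eq_zero_of_norm_eventuallyEq {r : E → E} {x : E} {R : ℝ} (hR : R ≠ 0)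
    (hr : DifferentiableAt ℝ r x) (hnorm : ∀ᶠ y in 𝓝 x, ‖r y‖ = R) : (fderiv ℝ r x).det = 0 := by
  have horth : ∀ v, inner ℝ (r x) (fderiv ℝ r x v) = 0 := by
    have hsq : HasFDerivAt (fun y => ‖r y‖ ^ 2) (0 : E →L[ℝ] ℝ) x :=
      (hasFDerivAt_const (R ^ 2) x).congr_of_eventuallyEq <|
        hnorm.mono fun y hy => congrArg (· ^ 2) hy
    intro v
    simpa using congrArg (fun L : E →L[ℝ] ℝ => L v) (hr.hasFDerivAt.norm_sq.unique hsq)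
  by_contra hdet
  obtain ⟨v, hv⟩ := (ContinuousLinearMap.isUnit_iff_bijective.1
    ((continuousLinearMap_isUnit_iff_det_ne_zero _).2 hdet)).2 (r x)
  have hrx : r x = 0 := inner_self_eq_zero.1 (hv ▸ horth v)
  exact hR <| by rw [← hnorm.self_of_nhds, hrx, norm_zero]

theorem exists_mem_ball_norm_ne_of_fixes_sphere {r : E → E} {K : ℝ≥0} {R : ℝ} (hR : 0 < R)
    (hr : LipschitzOnWith K r (closedBall 0 R)) (hd : DifferentiableOn ℝ r (ball 0 R))
    (hfix : ∀ x ∈ sphere 0 R, r x = x) : ∃ x ∈ ball 0 R, ‖r x‖ ≠ R := by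
  by_contra! hnorm
  borelize E
  let μ : Measure E := Measure.addHaar
  let w := (closedBall 0 R).indicator fun x => r x - x
  have hw : LipschitzWith (K + 1) w :=
    lipschitzWith_indicator_of_eq_zero_on_frontier isClosed_closedBall
      (hr.sub LipschitzWith.id.lipschitzOnWith) fun x hx => by
        rw [hfix x (frontier_closedBall_subset_sphere hx), sub_self]
  have hwr : ∀ x ∈ ball (0 : E) R, ∀ᶠ y in 𝓝 x, w y = r y - y := fun x hx =>
    (isOpen_ball.eventually_mem hx).mono fun y hy =>
      indicator_of_mem (ball_subset_closedBall hy) _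
  have hwd : ∀ x ∈ ball (0 : E) R, HasFDerivAt w (fderiv ℝ r x - 1) x := fun x hx =>
    ((hd.differentiableAt (isOpen_ball.mem_nhds hx)).hasFDerivAt.sub
      (hasFDerivAt_id x)).congr_of_eventuallyEq (hwr x hx)
  have hw0 : ∀ x ∉ ball (0 : E) R, w x = 0 := fun x hx =>
    indicator_apply_eq_zero.2 fun hx' => by
      rw [hfix x (by rw [← closedBall_sdiff_ball]; exact ⟨hx', hx⟩), sub_self]
  have hdet : ∀ x ∈ ball (0 : E) R, (1 + fderiv ℝ w x).det = 0 := fun x hx => by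
    rw [(hwd x hx).fderiv, add_sub_cancel]
    exact det_fderiv_eq_zero_of_norm_eventuallyEq hR.ne'
      (hd.differentiableAt (isOpen_ball.mem_nhds hx))
      ((isOpen_ball.eventually_mem hx).mono hnorm)
  have hvol : 0 = μ.real (ball 0 R) := by
    rw [← setIntegral_det_one_add_fderiv μ measurableSet_ball measure_ball_lt_top.ne hw
      (fun x hx => (hwd x hx).differentiableAt) hw0]
    exact (setIntegral_eq_zero_of_forall_eq_zero hdet).symm
  exact hvol.not_lt
    (ENNReal.toReal_pos (measure_ball_pos μ 0 hR).ne' measure_ball_lt_top.ne)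

theorem exists_eq_zero_of_contDiff_of_norm_sub_le {F : E → E} {C : ℝ} (hF : ContDiff ℝ 1 F)
    (hC : ∀ x, ‖F x - x‖ ≤ C) : ∃ x, F x = 0 := by
  by_contra! hne
  have hC0 : 0 ≤ C := (norm_nonneg _).trans (hC 0)
  let χ : ContDiffBump (0 : E) := ⟨C + 1, C + 2, by positivity, by linarith⟩
  let V : E → E := fun x => x + χ x • (F x - x)
  have hV : ContDiff ℝ 1 V := contDiff_id.add (χ.contDiff.smul (hF.sub contDiff_id))
  have hV0 : ∀ x, V x ≠ 0 := by
    intro x hx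
    rcases le_or_gt ‖x‖ (C + 1) with hin | hout
    · have hχ : χ x = 1 := χ.one_of_mem_closedBall (mem_closedBall_zero_iff.2 hin)
      exact hne x (by simpa [V, hχ] using hx)
    · have hle : ‖x‖ ≤ C := calc
        ‖x‖ = χ x * ‖F x - x‖ := by
          rw [← Real.norm_of_nonneg (χ.nonneg (x := x)), ← norm_smul, ← norm_neg (_ • _),
            ← eq_neg_of_add_eq_zero_left hx]
        _ ≤ C := (mul_le_of_le_one_left (norm_nonneg _) χ.le_one).trans (hC x)
      linarith
  let r : E → E := fun x => ((C + 2) * ‖V x‖⁻¹) • V x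
  have hr : ContDiff ℝ 1 r := (contDiff_const.mul
    ((hV.norm ℝ hV0).inv fun x => norm_ne_zero_iff.2 (hV0 x))).smul hV
  have hnorm : ∀ x, ‖r x‖ = C + 2 := fun x => by
    rw [norm_smul, norm_mul, norm_inv, norm_norm, Real.norm_of_nonneg (by positivity),
      inv_mul_cancel_right₀ (norm_ne_zero_iff.2 (hV0 x))]
  obtain ⟨K, hK⟩ := LocallyLipschitzOn.exists_lipschitzOnWith_of_compact
    (isCompact_closedBall (0 : E) (C + 2)) hr.locallyLipschitz.locallyLipschitzOn
  obtain ⟨x, -, hx⟩ := exists_mem_ball_norm_ne_of_fixes_sphere (by positivity) hK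
    (hr.differentiable one_ne_zero).differentiableOn fun x hx => by
      have hxR : ‖x‖ = C + 2 := mem_sphere_zero_iff_norm.1 hx
      have hχ : χ x = 0 := χ.zero_of_le_dist (by rw [dist_zero_right, hxR])
      have hR : C + 2 ≠ 0 := by positivity
      simp [r, V, hχ, hxR, hR]
  exact hx (hnorm x)

theorem exists_eq_zero_of_continuous_of_norm_sub_le {F : E → E} {C : ℝ} (hF : Continuous F)
    (hC : ∀ x, ‖F x - x‖ ≤ C) : ∃ x, F x = 0 := by
  by_contra! hne
  obtain ⟨W, hW, hWF, -⟩ := hF.exists_contDiff_approx 1 (ε := fun x => min 1 ‖F x‖)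
    (continuous_const.min hF.norm) fun x => lt_min one_pos (norm_pos_iff.2 (hne x))
  obtain ⟨x, hx⟩ := exists_eq_zero_of_contDiff_of_norm_sub_le (C := 1 + C) hW fun x => calc
    ‖W x - x‖ ≤ ‖W x - F x‖ + ‖F x - x‖ := norm_sub_le_norm_sub_add_norm_sub _ _ _
    _ ≤ 1 + C := by
      rw [← dist_eq_norm]
      exact add_le_add ((hWF x).le.trans (min_le_left _ _)) (hC x)
  have hlt := (hWF x).trans_le (min_le_right _ _)
  rw [hx, dist_zero_left] at hlt
  exact hlt.false

end Retraction

section Dimension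

variable {E F : Type*} [NormedAddCommGroup E] [NormedSpace ℝ E] [FiniteDimensional ℝ E]

theorem surjective_of_continuous_of_norm_sub_le {φ : E → E} {C : ℝ} (hφ : Continuous φ)
    (hC : ∀ x, ‖φ x - x‖ ≤ C) : Function.Surjective φ := by
  intro c
  let e : E ≃L[ℝ] EuclideanSpace ℝ (Fin (finrank ℝ E)) := toEuclidean
  let T : E →L[ℝ] EuclideanSpace ℝ (Fin (finrank ℝ E)) := e
  obtain ⟨x, hx⟩ := exists_eq_zero_of_continuous_of_norm_sub_le
    (F := fun x => e (φ (e.symm x) - c)) (C := ‖T‖ * (C + ‖c‖)) (by fun_prop)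
    fun x => by
      obtain ⟨y, rfl⟩ := e.surjective x
      rw [e.symm_apply_apply, ← map_sub]
      refine T.le_of_opNorm_le_of_le le_rfl ?_
      calc ‖φ y - c - y‖ = ‖φ y - y - c‖ := by rw [sub_right_comm]
        _ ≤ ‖φ y - y‖ + ‖c‖ := norm_sub_le _ _
        _ ≤ C + ‖c‖ := by gcongr; exact hC y
  exact ⟨e.symm x, sub_eq_zero.1 (e.map_eq_zero_iff.1 hx)⟩

variable [NormedAddCommGroup F] [NormedSpace ℝ F] [FiniteDimensional ℝ F]

theorem not_leftInverse_of_continuous_of_finrank_lt {f : E → F} {g : F → E}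
    (hdim : finrank ℝ F < finrank ℝ E) (hf : Continuous f) (hg : Continuous g) :
    ¬ Function.LeftInverse g f := by
  intro hgf
  obtain ⟨G, hG, hGg, -⟩ := hg.exists_contDiff_approx 1 (ε := fun _ => 1) continuous_const
    fun _ => one_pos
  obtain ⟨c, hc⟩ := (hG.dense_compl_range_of_finrank_lt_finrank hdim).nonempty
  have hclose : ∀ x, ‖G (f x) - x‖ ≤ 1 := fun x => by
    simpa only [dist_eq_norm, hgf x] using (hGg (f x)).le
  obtain ⟨x, hx⟩ := surjective_of_continuous_of_norm_sub_le (hG.continuous.comp hf) hclose c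
  exact hc ⟨f x, hx⟩

end Dimension

section Law

variable {Ω : Type*} [MeasurableSpace Ω] {μ : Measure Ω}

theorem eq_of_ae_comp_eq_of_isOpenPosMeasure_map {X Y : Type*} [TopologicalSpace X]
    [MeasurableSpace X] [OpensMeasurableSpace X] [TopologicalSpace Y] [T2Space Y] {Z : Ω → X}
    (hZm : AEMeasurable Z μ) [(μ.map Z).IsOpenPosMeasure] {u v : X → Y} (hu : Continuous u)
    (hv : Continuous v) (huv : ∀ᵐ ω ∂μ, u (Z ω) = v (Z ω)) : u = v :=
  Continuous.ae_eq_iff_eq (μ.map Z) hu hv |>.1 <|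
    (ae_map_iff hZm (isClosed_eq hu hv).measurableSet).2 huv

theorem isOpenPosMeasure_map_pi_of_iIndepFun [IsProbabilityMeasure μ] {ι : Type*} [Finite ι]
    {𝓧 : ι → Type*} [∀ i, TopologicalSpace (𝓧 i)] [∀ i, MeasurableSpace (𝓧 i)]
    {X : ∀ i, Ω → 𝓧 i} (hX : ∀ i, AEMeasurable (X i) μ)
    [∀ i, (μ.map (X i)).IsOpenPosMeasure] (hind : iIndepFun X μ) :
    (μ.map fun ω i => X i ω).IsOpenPosMeasure := by
  have := Fintype.ofFinite ι
  have := fun i => Measure.isProbabilityMeasure_map (hX i)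
  rw [(iIndepFun_iff_map_fun_eq_pi_map hX).1 hind]
  infer_instance

theorem isOpenPosMeasure_map_pi_of_gaussianReal [IsProbabilityMeasure μ] {ι : Type*} [Finite ι]
    {X : ι → Ω → ℝ} {m : ι → ℝ} {v : ι → ℝ≥0} (hv : ∀ i, v i ≠ 0)
    (hX : ∀ i, HasLaw (X i) (gaussianReal (m i) (v i)) μ) (hind : iIndepFun X μ) :
    (μ.map fun ω i => X i ω).IsOpenPosMeasure := by
  have : ∀ i, (μ.map (X i)).IsOpenPosMeasure := fun i => by
    rw [(hX i).map_eq]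
    exact (gaussianReal_absolutelyContinuous' _ (hv i)).isOpenPosMeasure
  exact isOpenPosMeasure_map_pi_of_iIndepFun (fun i => (hX i).aemeasurable) hind

variable {E F : Type*} [NormedAddCommGroup E] [NormedSpace ℝ E] [FiniteDimensional ℝ E]
  [MeasurableSpace E] [OpensMeasurableSpace E] [NormedAddCommGroup F] [NormedSpace ℝ F]
  [FiniteDimensional ℝ F]

theorem not_ae_eq_comp_of_finrank_lt (hdim : finrank ℝ F < finrank ℝ E) {Z : Ω → E} {Y : Ω → F}
    (hZ : (μ.map Z).IsOpenPosMeasure) {f : E → F} {g : F → E} (hf : Continuous f)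
    (hg : Continuous g) (hZY : ∀ᵐ ω ∂μ, Z ω = g (Y ω)) : ¬ ∀ᵐ ω ∂μ, Y ω = f (Z ω) := by
  intro hYZ
  have hgf : g ∘ f = id := by
    refine eq_of_ae_comp_eq_of_isOpenPosMeasure_map
      (.of_map_ne_zero (NeZero.ne (μ.map Z))) (hg.comp hf) continuous_id ?_
    filter_upwards [hZY, hYZ] with ω hz hy
    rw [Function.comp_apply, ← hy, ← hz, id]
  exact not_leftInverse_of_continuous_of_finrank_lt hdim hf hg (congrFun hgf)

theorem theorem1_general [MeasurableSpace F] [OpensMeasurableSpace F]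
    (hdim : finrank ℝ E ≠ finrank ℝ F) {Z : Ω → E} {Y : Ω → F}
    (hZ : (μ.map Z).IsOpenPosMeasure) (hY : (μ.map Y).IsOpenPosMeasure) :
    ¬ ∃ (f : E → F) (g : F → E), Continuous f ∧ Continuous g ∧
      (∀ᵐ ω ∂μ, Z ω = g (Y ω)) ∧ (∀ᵐ ω ∂μ, Y ω = f (Z ω)) := by
  rintro ⟨f, g, hf, hg, hZY, hYZ⟩
  rcases hdim.lt_or_gt with hlt | hgt
  · exact not_ae_eq_comp_of_finrank_lt hlt hY hg hf hYZ hZY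
  · exact not_ae_eq_comp_of_finrank_lt hgt hZ hf hg hZY hYZ

end Law

theorem theorem1 {Ω : Type*} [MeasurableSpace Ω] (μ : Measure Ω) [IsProbabilityMeasure μ]
    (H P : ℕ) (hHP : H ≠ P)
    (z : Fin H → Ω → ℝ) (y : Fin P → Ω → ℝ)
    (hz : ∀ i, HasLaw (z i) (gaussianReal 0 1) μ) (hz_indep : iIndepFun z μ)
    (hy : ∀ j, HasLaw (y j) (gaussianReal 0 1) μ) (hy_indep : iIndepFun y μ) :
    ¬ ∃ (f : (Fin H → ℝ) → (Fin P → ℝ)) (g : (Fin P → ℝ) → (Fin H → ℝ)),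
      Continuous f ∧ Continuous g ∧
      (∀ᵐ ω ∂μ, (fun i => z i ω) = g (fun j => y j ω)) ∧
      (∀ᵐ ω ∂μ, (fun j => y j ω) = f (fun i => z i ω)) :=
  theorem1_general (by simpa only [finrank_fin_fun] using hHP)
    (isOpenPosMeasure_map_pi_of_gaussianReal (fun _ => one_ne_zero) hz hz_indep)
    (isOpenPosMeasure_map_pi_of_gaussianReal (fun _ => one_ne_zero) hy hy_indep)
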